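/- Write $\log x=\ln(\max(x,e))$ for the truncated logarithm, and let $\mathcal F$ be a class of measurable functions $\mathcal X\to\mathcal Y=\{1,-1\}$ on a measurable space $\mathcal X$. **Definitions.** A *sample compression scheme of size $k$* for $\mathcal F$ consists of functions $\kappa_n$ $(n\in\mathbb N)$, invariant under permutations of their $n$ arguments, that send a sample in $(\mathcal X\times\mathcal Y)^n$ to a tuple of at most $k$ elements of $\mathcal X\times\mathcal Y$, and of a function $\rho$ that sends every such tuple to a function $\mathcal X\to\mathcal Y$, such that for all $n$, all $f\in\mathcal F$ and every sample $S=(x_i,f(x_i))_{i=1}^n$ the entries of $\kappa_n(S)$ belong to $S$, and $\rho(\kappa_n(S))(x_i)=f(x_i)$ for $i=1,\dots,n$. The scheme is *stable* if for all such $S$ and every element $(x,y)$ of $S$ that does not occur in $\kappa_n(S)$ we have $\kappa_{n-1}(S\setminus(x,y))=\kappa_n(S)$, where $S\setminus(x,y)$ is $S$ with one occurrence of $(x,y)$ deleted. A stable scheme is *homogeneous* if, moreover, for all such $S$ and every $(x,y)$ in $\kappa_n(S)$ we have $\kappa_n(S)\setminus\{(x,y)\}\subseteq\kappa_{n-1}(S\setminus(x,y))$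 (as sets). The *VC dimension* of a class of functions $\mathcal X\to\mathcal Y$ is the largest size of a finite set on which the class realizes all labelings. **Setting (realizable case).** Let $X,X_1,X_2,\dots$ be i.i.d. with an arbitrary law $P$ on $\mathcal X$, let $f^*\in\mathcal F$, and let $Y_i=f^*(X_i)$. The risk of $h:\mathcal X\to\mathcal Y$ is $R(h)=P(h(X)\ne f^*(X))$. Let $(\kappa_n,\rho)$ be a stable sample compression scheme of size $k$ for $\mathcal F$, and let $\hat f=\hat f_n=\rho(\kappa_n((X_i,Y_i)_{i=1}^n))$; assume that for each $m$ the value $\hat f_m(x)$ is jointly measurable in $(X_1,\dots,X_m)$ and $x$. **Theorem.** There are a universal constant $c>0$ and, for each $A>0$, a constant $c_A>0$ depending only on $A$, such that in the above setting, for all $n\ge 1$ and $\delta\in(0,1)$: 1. $\displaystyle \mathbb E\,R(\hat f)\le \frac{k}{n+1}$. 2. With probability at least $1-\delta$, $\displaystyle R(\hat f)\le c\,\frac{k\log(1/\delta)}{n}$. 3. Suppose that $\rho$ takes its values in a class of VC dimension $d\le A k$. For the sample $S=(X_i,Y_i)_{i=1}^{3n}$ of size $3n$, let $\hat g(x)$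 be the majority vote of $\hat f_n(x),\hat f_{2n}(x),\hat f_{3n}(x)$, the outputs of the scheme on the first $n$ elements of $S$, on the first $2n$ elements of $S$, and on all of $S$. Then with probability at least $1-\delta$, $\displaystyle R(\hat g)\le c_A\left(\frac{k\log k}{n}+\frac{\log(1/\delta)}{n}\right)$. 4. If the scheme is homogeneous, then with probability at least $1-\delta$, $\displaystyle R(\hat f)\le c\left(\frac{k}{n}+\frac{\log(1/\delta)}{n}\right)$. -/

import Mathlib

open MeasureTheory

universe u

/-- The truncated logarithm `ln (max x e)`. -/
noncomputable def truncLog (x : ℝ) : ℝ := Real.log (max x (Real.exp 1))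

/-- The sample `(x₁, f(x₁)), …, (xₙ, f(xₙ))`.  Labels are Booleans: `true` stands for `+1`
and `false` for `-1`. -/
def labeledSample {X : Type u} {n : ℕ} (f : X → Bool) (x : Fin n → X) : Fin n → X × Bool :=
  fun i => (x i, f (x i))

/-- A sample compression scheme of size `k` for the class `F`: permutation invariant compression
functions `κₙ`, whose values are tuples (lists) of at most `k` labeled points, and a
reconstruction function `ρ`, such that on every sample labeled by some `f ∈ F` the compression
set consists of points of the sample and its reconstruction is correct on the whole sample.
Only the values of `ρ` on lists of length at most `k` are relevant. -/
structure CompressionScheme {X : Type u} (F : Set (X → Bool)) (k : ℕ) where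
  /-- The compression functions `κₙ`. -/
  compress : (n : ℕ) → (Fin n → X × Bool) → List (X × Bool)
  /-- The reconstruction function `ρ`. -/
  reconstruct : List (X × Bool) → X → Bool
  length_compress_le : ∀ (n : ℕ) (S : Fin n → X × Bool), (compress n S).length ≤ k
  compress_perm : ∀ (n : ℕ) (S : Fin n → X × Bool) (σ : Equiv.Perm (Fin n)),
    compress n (S ∘ σ) = compress n S
  compress_subset : ∀ (n : ℕ), ∀ f ∈ F, ∀ (x : Fin n → X),
    ∀ z ∈ compress n (labeledSample f x), z ∈ Set.range (labeledSample f x)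
  reconstruct_correct : ∀ (n : ℕ), ∀ f ∈ F, ∀ (x : Fin n → X) (i : Fin n),
    reconstruct (compress n (labeledSample f x)) (x i) = f (x i)

namespace CompressionScheme

variable {X : Type u} {F : Set (X → Bool)} {k : ℕ}

/-- The output `f̂ = ρ(κₙ(S))` of the scheme on the sample `S`. -/
def output (C : CompressionScheme F k) {n : ℕ} (S : Fin n → X × Bool) : X → Bool :=
  C.reconstruct (C.compress n S)

/-- Stability: deleting from a realizable sample one element that does not belong to the
compression set leaves the compression set unchanged. -/
def IsStable (C : CompressionScheme F k) : Prop :=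
  ∀ (n : ℕ), ∀ f ∈ F, ∀ (x : Fin (n + 1) → X) (i : Fin (n + 1)),
    labeledSample f x i ∉ C.compress (n + 1) (labeledSample f x) →
      C.compress n (i.removeNth (labeledSample f x)) = C.compress (n + 1) (labeledSample f x)

/-- Homogeneity: the scheme is stable, and deleting from a realizable sample one element of the
compression set keeps all other elements of the compression set in the new compression set. -/
def IsHomogeneous (C : CompressionScheme F k) : Prop :=
  C.IsStable ∧
  ∀ (n : ℕ), ∀ f ∈ F, ∀ (x : Fin (n + 1) → X) (i : Fin (n + 1)),
    labeledSample f x i ∈ C.compress (n + 1) (labeledSample f x) →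
      ∀ z ∈ C.compress (n + 1) (labeledSample f x), z ≠ labeledSample f x i →
        z ∈ C.compress n (i.removeNth (labeledSample f x))

/-- The majority vote of three labels. -/
def majority (a b c : Bool) : Bool := (a && b) || (a && c) || (b && c)

/-- The modified output `ĝ` on a sample `S` of size `3n`: the pointwise majority vote of the
outputs of the scheme on the first `n` elements, on the first `2n` elements, and on all of `S`. -/
def majorityOutput (C : CompressionScheme F k) {n : ℕ} (S : Fin (3 * n) → X × Bool) :
    X → Bool :=
  fun x => majority
    (C.output (Fin.take n (by omega) S) x)
    (C.output (Fin.take (2 * n) (by omega) S) x)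
    (C.output S x)

end CompressionScheme

/-- `H` shatters the finite set `s` if every labeling of `s` is realized by a member of `H`. -/
def ShattersSet {X : Type u} (H : Set (X → Bool)) (s : Finset X) : Prop :=
  ∀ b : X → Bool, ∃ h ∈ H, ∀ x ∈ s, h x = b x

/-- The VC dimension: the supremum of the sizes of the finite sets shattered by `H`. -/
noncomputable def vcDimension {X : Type u} (H : Set (X → Bool)) : ℕ∞ :=
  ⨆ (s : Finset X) (_ : ShattersSet H s), (s.card : ℕ∞)

/-- The risk `P(h(X) ≠ f(X))` of `h` for the binary loss, when the true labels are `Y = f(X)`. -/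
noncomputable def risk {X : Type u} [MeasurableSpace X] (P : Measure X) (f h : X → Bool) : ℝ :=
  P.real {x | h x ≠ f x}

/-- The law of `n` independent points with common law `P`. -/
noncomputable def iidLaw {X : Type u} [MeasurableSpace X] (P : Measure X) (n : ℕ) :
    Measure (Fin n → X) :=
  Measure.pi fun _ => P

/-!
Every part of the theorem follows from stability.

*Expectation.*  The expected risk is the probability that the scheme trained on `n` of `n + 1`
exchangeable points errs at the remaining one.  By stability, an error at the left out point forces
this point into the compression set of all `n + 1` points, and a point occurring twice is never
misclassified, so at most `k` of the `n + 1` points are misclassified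
(`CompressionScheme.IsStable.integral_risk_le`).

*High probability.*  The bound `R ≤ 64 (k + log (1 / δ)) / n` holds for every stable scheme
(`CompressionScheme.IsStable.one_sub_le_real_risk_le`); it implies the three remaining claims,
except that for `k = 0` the second one needs risk zero, which holds since the output is then a fixed
function (`CompressionScheme.risk_output_eq_zero`).  If the risk of the output on a sample is large, then the output errs often on an independent second
sample, say at `2 * e` or more points with `e` of order `R * n`.  Conditionally on the family `T`
of all `2 * n` points, the sample is a uniformly random subfamily `S` of size `n`, whose error set
consists of values in `T` which do not occur in `S`.  Choose a random set `V` of values in `T`.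
With probability at least `2 ^ (-(k + 1))`, the set `V` contains the compression set and leaves out
half of the errors (`two_pow_card_le_card_filter_subset`).  When this happens, stability shows that
the error set is determined by the part of `S` with values in `V`, and the rest of `S` has to avoid
`e` determined points outside `V`.  For fixed `V` this is no more likely than avoiding `e` fixed
points (`card_filter_disjoint_determined_le`), an event of probability at most `2 ^ (-e)`.  Hence
the bad event has probability of order `2 ^ (k - e)` (`card_filter_subsample_le`).

The random set consists of values and not of indices because stability allows a sample entry to be
deleted only if its value does not occur in the compression set: deleting one of several copies of
a compression point may change the compression set, and the law of the points may have atoms.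
-/

/-! ### Counting subsets -/

/-- A permutation moving one finite set into another of the same size, both contained in `W`,
without moving any point outside `W`. -/
lemma exists_perm_maps_finset_fixing_compl {ι : Type*} [Finite ι] {W D E : Finset ι} (hD : D ⊆ W)
    (hE : E ⊆ W) (hcard : D.card = E.card) :
    ∃ σ : Equiv.Perm ι, (∀ i ∈ E, σ.symm i ∈ D) ∧ ∀ i ∉ W, σ i = i := by
  classical
  let e := Finset.equivOfCardEq hcard
  obtain ⟨σ, hσ⟩ := Equiv.Perm.exists_extending_pair
    (Sum.elim (fun a : D => (a : ι)) (fun b : {i // i ∉ W} => (b : ι)))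
    (Sum.elim (fun a : D => (e a : ι)) (fun b : {i // i ∉ W} => (b : ι)))
    (by
      refine Function.Injective.sumElim Subtype.val_injective Subtype.val_injective ?_
      rintro ⟨a, ha⟩ ⟨b, hb⟩ h
      exact hb ((show a = b from h) ▸ hD ha))
    (by
      refine Function.Injective.sumElim (Subtype.val_injective.comp e.injective)
        Subtype.val_injective ?_
      rintro a ⟨b, hb⟩ h
      exact hb ((show (e a : ι) = b from h) ▸ hE (e a).2))
  refine ⟨σ, fun i hi => ?_, fun i hi => hσ (Sum.inr ⟨i, hi⟩)⟩
  have := hσ (Sum.inl (e.symm ⟨i, hi⟩))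
  simp only [Sum.elim_inl, Equiv.apply_symm_apply] at this
  rw [← this, Equiv.symm_apply_apply]
  exact (e.symm ⟨i, hi⟩).2

/-- If the part of `S` outside `W` determines a set `D (S \ W) ⊆ W` of at least `e` points which
`S` has to avoid, then there are no more such sets `S` of size `n` than sets of size `n` avoiding
one fixed set of `e` points. -/
lemma card_filter_disjoint_determined_le {ι : Type*} [Fintype ι] [DecidableEq ι] (n e : ℕ)
    (W : Finset ι) (D : Finset ι → Finset ι) :
    ((Finset.powersetCard n (Finset.univ : Finset ι)).filter fun S =>
      e ≤ (D (S \ W)).card ∧ D (S \ W) ⊆ W ∧ Disjoint S (D (S \ W))).card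
      ≤ (Fintype.card ι - e).choose n := by
  rcases Finset.eq_empty_or_nonempty ((Finset.powersetCard n (Finset.univ : Finset ι)).filter
    fun S => e ≤ (D (S \ W)).card ∧ D (S \ W) ⊆ W ∧ Disjoint S (D (S \ W))) with h0 | ⟨S₀, hS₀⟩
  · simp [h0]
  obtain ⟨-, he₀, hW₀, -⟩ := Finset.mem_filter.1 hS₀
  obtain ⟨E, hE, hEcard⟩ := Finset.exists_subset_card_eq he₀
  have key : ∀ A : Finset ι, ∃ σ : Equiv.Perm ι, (e ≤ (D A).card → D A ⊆ W →
      ∀ i ∈ E, σ.symm i ∈ D A) ∧ ∀ i ∉ W, σ i = i := by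
    intro A
    by_cases hA : e ≤ (D A).card ∧ D A ⊆ W
    · obtain ⟨D', hD', hcard⟩ := Finset.exists_subset_card_eq hA.1
      obtain ⟨σ, h1, h2⟩ := exists_perm_maps_finset_fixing_compl (hD'.trans hA.2)
        (hE.trans hW₀) (hcard.trans hEcard.symm)
      exact ⟨σ, fun _ _ i hi => hD' (h1 i hi), h2⟩
    · exact ⟨1, fun h h' => absurd ⟨h, h'⟩ hA, fun _ _ => rfl⟩
  choose σ hσD hσW using key
  have hmap : ∀ S : Finset ι, S.map (σ (S \ W)).toEmbedding \ W = S \ W := by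
    intro S
    -- a permutation fixing the complement of `W` preserves `W`
    have hW : ∀ i, (σ (S \ W)) i ∉ W ↔ i ∉ W := by
      intro i
      refine ⟨fun h => ?_, fun h => by rwa [hσW _ _ h]⟩
      have := (σ (S \ W)).injective (hσW (S \ W) _ h)
      rwa [this] at h
    ext i
    simp only [Finset.mem_sdiff, Finset.mem_map_equiv]
    have h3 := hW ((σ (S \ W)).symm i)
    rw [Equiv.apply_symm_apply] at h3
    constructor
    · rintro ⟨h1, h2⟩
      have h4 := hσW (S \ W) _ (h3.1 h2)
      rw [Equiv.apply_symm_apply] at h4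
      exact ⟨h4 ▸ h1, h2⟩
    · rintro ⟨h1, h2⟩
      have h4 := hσW (S \ W) _ (h3.1 h2)
      rw [Equiv.apply_symm_apply] at h4
      exact ⟨h4 ▸ h1, h2⟩
  have hcardt : (Finset.powersetCard n (Finset.univ \ E)).card
      = (Fintype.card ι - e).choose n := by
    rw [Finset.card_powersetCard, Finset.card_sdiff_of_subset (Finset.subset_univ _), hEcard,
      Finset.card_univ]
  rw [← hcardt]
  refine Finset.card_le_card_of_injOn (fun S => S.map (σ (S \ W)).toEmbedding) ?_ ?_
  · intro S hS
    obtain ⟨hn, he, hDW, hdisj⟩ := Finset.mem_filter.1 hS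
    refine Finset.mem_powersetCard.2 ⟨fun i hi => ?_, ?_⟩
    · rw [Finset.mem_map_equiv] at hi
      refine Finset.mem_sdiff.2 ⟨Finset.mem_univ _, fun hiE => ?_⟩
      exact Finset.disjoint_left.1 hdisj hi (hσD (S \ W) he hDW i hiE)
    · simpa using (Finset.mem_powersetCard.1 hn).2
  · intro S _ S' _ h
    have h1 : S \ W = S' \ W := by rw [← hmap S, ← hmap S']; exact congrArg (· \ W) h
    simp only [h1] at h
    exact Finset.map_injective _ h

/-- Among the subsets of a set of `2 * n` points, those of size `n` become at least twice as rare
with each point to be avoided. -/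
lemma two_pow_mul_choose_sub_le (n e : ℕ) (hn : 1 ≤ n) :
    2 ^ e * (2 * n - e).choose n ≤ (2 * n).choose n := by
  induction e with
  | zero => simp
  | succ e ih =>
    refine le_trans ?_ ih
    rw [pow_succ, mul_assoc]
    refine Nat.mul_le_mul_left _ ?_
    obtain ⟨M, hM⟩ : ∃ M, 2 * n - e = M := ⟨_, rfl⟩
    have hM' : 2 * n - (e + 1) = M - 1 := by omega
    rw [hM', hM]
    rcases M with _ | M
    · rw [Nat.choose_eq_zero_of_lt (by omega)]; omega
    · have h := Nat.choose_mul_succ_eq M n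
      have h2 : M + 1 ≤ 2 * n := by omega
      rw [Nat.add_sub_cancel]
      rcases Nat.lt_or_ge M n with hlt | hge
      · rw [Nat.choose_eq_zero_of_lt hlt]; omega
      · have h3 : 2 * (M + 1 - n) ≤ M + 1 := by omega
        have h4 : (M.choose n) * 2 * (M + 1) ≤ (M + 1).choose n * (M + 1) := by
          calc (M.choose n) * 2 * (M + 1) = (M.choose n * (M + 1)) * 2 := by ring
            _ = (M + 1).choose n * (2 * (M + 1 - n)) := by rw [h]; ring
            _ ≤ _ := Nat.mul_le_mul_left _ h3
        have := Nat.le_of_mul_le_mul_right h4 (by omega)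
        omega

/-- A set `K` of at most `k` points, and a set `E` of points with weights `w`, disjoint from `K`:
at least a fraction `2 ^ (-(k + 1))` of the subsets `V` of `U` contain `K` and leave out at least
half of the weight of `E`. -/
lemma two_pow_card_le_card_filter_subset {β : Type*} [DecidableEq β] {U K E : Finset β}
    (hK : K ⊆ U) (hE : E ⊆ U) (hKE : Disjoint K E) {k e : ℕ} (hk : K.card ≤ k) (w : β → ℕ)
    (hw : 2 * e ≤ ∑ b ∈ E, w b) :
    2 ^ U.card ≤ 2 ^ (k + 1) *
      (U.powerset.filter fun V => K ⊆ V ∧ e ≤ ∑ b ∈ E \ V, w b).card := by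
  have hIcc : (Finset.Icc K U).card = 2 ^ (U.card - K.card) := Finset.card_Icc_finset hK
  set G := U.powerset.filter fun V => K ⊆ V ∧ e ≤ ∑ b ∈ E \ V, w b with hG
  -- flipping membership of the points of `E` exchanges the parts of `E` inside and outside `V`
  have hcover : Finset.Icc K U ⊆ G ∪ G.image (fun V => symmDiff V E) := by
    intro V hV
    obtain ⟨hKV, hVU⟩ := Finset.mem_Icc.1 hV
    have hsum : ∑ b ∈ E \ V, w b + ∑ b ∈ E ∩ V, w b = ∑ b ∈ E, w b := by
      rw [← Finset.sum_union (Finset.disjoint_sdiff_inter E V), Finset.sdiff_union_inter]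
    rcases le_or_gt e (∑ b ∈ E \ V, w b) with h | h
    · exact Finset.mem_union_left _ (Finset.mem_filter.2 ⟨Finset.mem_powerset.2 hVU, hKV, h⟩)
    · refine Finset.mem_union_right _ (Finset.mem_image.2 ⟨symmDiff V E, ?_, ?_⟩)
      · refine Finset.mem_filter.2 ⟨Finset.mem_powerset.2 ?_, ?_, ?_⟩
        · intro b hb
          rcases Finset.mem_symmDiff.1 hb with hb | hb
          exacts [hVU hb.1, hE hb.1]
        · intro b hb
          exact Finset.mem_symmDiff.2 (Or.inl ⟨hKV hb, Finset.disjoint_left.1 hKE hb⟩)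
        · have : E \ symmDiff V E = E ∩ V := by
            ext b
            simp only [Finset.mem_sdiff, Finset.mem_symmDiff, Finset.mem_inter]
            tauto
          rw [this]
          omega
      · exact symmDiff_symmDiff_cancel_right _ _
  have h1 : 2 ^ (U.card - K.card) ≤ 2 * G.card := by
    rw [← hIcc]
    calc (Finset.Icc K U).card ≤ (G ∪ G.image (fun V => symmDiff V E)).card :=
          Finset.card_le_card hcover
      _ ≤ G.card + (G.image (fun V => symmDiff V E)).card := Finset.card_union_le _ _
      _ ≤ 2 * G.card := by
          have := Finset.card_image_le (s := G) (f := fun V => symmDiff V E)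
          omega
  have hKU := Finset.card_le_card hK
  calc 2 ^ U.card = 2 ^ K.card * 2 ^ (U.card - K.card) := by
        rw [← pow_add]; congr 1; omega
    _ ≤ 2 ^ k * (2 * G.card) := Nat.mul_le_mul (Nat.pow_le_pow_right (by norm_num) hk) h1
    _ = 2 ^ (k + 1) * G.card := by ring

/-- The combinatorial core.  To each subsample `S` of a family `T` of points there are attached
a set `K S` of at most `k` values of the subsample and a set `E S` of values not occurring in it,
such that passing to the entries of `S` with values in some `V ⊇ K S` does not change `E S`.
Then only few subsamples of size `n` have a set `E S` that occurs `2 * e` times in `T`. -/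
lemma card_filter_subsample_le {ι β : Type*} [Fintype ι] [DecidableEq ι] [DecidableEq β]
    (T : ι → β) (K E : Finset ι → Finset β) (n k e : ℕ)
    (hKk : ∀ S, (K S).card ≤ k) (hKS : ∀ S, K S ⊆ S.image T)
    (hES : ∀ S, Disjoint (S.image T) (E S)) (hEU : ∀ S, E S ⊆ Finset.univ.image T)
    (hstable : ∀ S V, K S ⊆ V → E (S.filter fun i => T i ∈ V) = E S) :
    ((Finset.powersetCard n (Finset.univ : Finset ι)).filter fun S =>
      2 * e ≤ (Finset.univ.filter fun i => T i ∈ E S).card).card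
      ≤ 2 ^ (k + 1) * (Fintype.card ι - e).choose n := by
  set U : Finset β := Finset.univ.image T with hU
  set bad := (Finset.powersetCard n (Finset.univ : Finset ι)).filter fun S =>
      2 * e ≤ (Finset.univ.filter fun i => T i ∈ E S).card with hbad
  let w : β → ℕ := fun b => (Finset.univ.filter fun i => T i = b).card
  have hw : ∀ B : Finset β, ∑ b ∈ B, w b = (Finset.univ.filter fun i => T i ∈ B).card := by
    intro B
    rw [Finset.card_eq_sum_card_fiberwise (f := T) (t := B)
      (by intro i hi; simpa using hi)]
    refine Finset.sum_congr rfl fun b hb => ?_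
    rw [Finset.filter_filter]
    refine congrArg Finset.card (Finset.ext fun i => ?_)
    simp only [Finset.mem_filter, Finset.mem_univ, true_and]
    exact ⟨fun h => ⟨h ▸ hb, h⟩, fun h => h.2⟩
  let r : Finset ι → Finset β → Prop := fun S V => K S ⊆ V ∧ e ≤ ∑ b ∈ E S \ V, w b
  have hmany : ∀ S ∈ bad, 2 ^ U.card ≤ 2 ^ (k + 1) * (U.powerset.bipartiteAbove r S).card := by
    intro S hS
    refine two_pow_card_le_card_filter_subset ?_ (hEU S) ?_ (hKk S) w ?_
    · exact (hKS S).trans (Finset.image_subset_image (Finset.subset_univ _))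
    · exact Finset.disjoint_of_subset_left (hKS S) (hES S)
    · rw [hw]
      exact (Finset.mem_filter.1 hS).2
  have hfew : ∀ V ∈ U.powerset, (bad.bipartiteBelow r V).card
      ≤ (Fintype.card ι - e).choose n := by
    intro V _
    refine le_trans (Finset.card_le_card ?_) (card_filter_disjoint_determined_le n e
      (Finset.univ.filter fun i => T i ∉ V)
      (fun A => Finset.univ.filter fun i => T i ∈ E A \ V))
    intro S hS
    obtain ⟨hSbad, hKV, heV⟩ := Finset.mem_filter.1 hS
    have hA : S \ (Finset.univ.filter fun i => T i ∉ V) = S.filter fun i => T i ∈ V := by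
      ext i; simp
    refine Finset.mem_filter.2 ⟨(Finset.mem_filter.1 hSbad).1, ?_⟩
    rw [hA, hstable S V hKV, ← hw]
    refine ⟨heV, ?_, ?_⟩
    · intro i hi
      simp only [Finset.mem_filter, Finset.mem_univ, true_and, Finset.mem_sdiff] at hi ⊢
      exact hi.2
    · rw [Finset.disjoint_left]
      intro i hi hi'
      simp only [Finset.mem_filter, Finset.mem_univ, true_and, Finset.mem_sdiff] at hi'
      exact Finset.disjoint_left.1 (hES S) (Finset.mem_image_of_mem T hi) hi'.1
  have hdouble := Finset.sum_card_bipartiteAbove_eq_sum_card_bipartiteBelow (s := bad)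
    (t := U.powerset) r
  have h1 : bad.card * 2 ^ U.card
      ≤ 2 ^ (k + 1) * ∑ S ∈ bad, (U.powerset.bipartiteAbove r S).card := by
    rw [Finset.mul_sum, ← smul_eq_mul]
    exact Finset.card_nsmul_le_sum _ _ _ hmany
  have h2 : ∑ V ∈ U.powerset, (bad.bipartiteBelow r V).card
      ≤ 2 ^ U.card * (Fintype.card ι - e).choose n := by
    rw [← Finset.card_powerset, ← smul_eq_mul]
    exact Finset.sum_le_card_nsmul _ _ _ hfew
  have h3 : bad.card * 2 ^ U.card
      ≤ 2 ^ (k + 1) * (Fintype.card ι - e).choose n * 2 ^ U.card := by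
    calc _ ≤ _ := h1
      _ ≤ 2 ^ (k + 1) * (2 ^ U.card * (Fintype.card ι - e).choose n) := by
        rw [hdouble]; exact Nat.mul_le_mul_left _ h2
      _ = _ := by ring
  exact Nat.le_of_mul_le_mul_right h3 (by positivity)

/-! ### Stability under passing to subsamples -/

namespace CompressionScheme

variable {X : Type u} {F : Set (X → Bool)} {k : ℕ}

/-- Deleting any number of sample entries whose values do not occur in the compression set leaves
the compression set of a stable scheme unchanged. -/
lemma IsStable.compress_comp {C : CompressionScheme F k} (hC : C.IsStable) {f : X → Bool}
    (hf : f ∈ F) {n m : ℕ} (x : Fin n → X) (g : Fin m → Fin n) (hg : Function.Injective g)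
    (hdel : ∀ i ∉ Set.range g, labeledSample f x i ∉ C.compress n (labeledSample f x)) :
    C.compress m (labeledSample f (x ∘ g)) = C.compress n (labeledSample f x) := by
  induction n with
  | zero =>
    obtain rfl : m = 0 := by simpa using Fintype.card_le_of_injective g hg
    congr 1
    funext i
    exact i.elim0
  | succ n ih =>
    by_cases hsurj : Function.Surjective g
    · obtain rfl : m = n + 1 := by simpa using Fintype.card_of_bijective ⟨hg, hsurj⟩
      exact C.compress_perm (n + 1) (labeledSample f x) (Equiv.ofBijective g ⟨hg, hsurj⟩)
    · obtain ⟨i, hi⟩ := not_forall.1 hsurj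
      have hne : ∀ j, ∃ l, i.succAbove l = g j := fun j =>
        Fin.exists_succAbove_eq fun h => hi ⟨j, h⟩
      choose g' hg' using hne
      have hfac : i.succAbove ∘ g' = g := funext hg'
      have hstep : C.compress n (labeledSample f (x ∘ i.succAbove))
          = C.compress (n + 1) (labeledSample f x) := hC n f hf x i (hdel i hi)
      have hrec := ih (x ∘ i.succAbove) g' (Function.Injective.of_comp (hfac ▸ hg)) (by
        intro j hj
        rw [hstep]
        refine hdel (i.succAbove j) ?_
        rintro ⟨l, hl⟩
        exact hj ⟨l, Fin.succAbove_right_injective ((hg' l).trans hl)⟩)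
      rw [Function.comp_assoc, hfac, hstep] at hrec
      exact hrec

/-- Two subsamples of one family of points, the second contained in the first, have the same
compression set if the entries missing in the second do not occur in the compression set of the
first.  In particular the compression set does not depend on the enumeration of a subsample. -/
lemma IsStable.compress_comp_eq {C : CompressionScheme F k} (hC : C.IsStable) {f : X → Bool}
    (hf : f ∈ F) {ι : Type*} (T : ι → X) {n m : ℕ} (g : Fin n → ι) (g' : Fin m → ι)
    (hg : Function.Injective g) (hg' : Function.Injective g') (hsub : Set.range g' ⊆ Set.range g)
    (hdel : ∀ i, g i ∉ Set.range g' →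
      (T (g i), f (T (g i))) ∉ C.compress n (labeledSample f (T ∘ g))) :
    C.compress m (labeledSample f (T ∘ g')) = C.compress n (labeledSample f (T ∘ g)) := by
  have hfac : ∀ j, ∃ l, g l = g' j := fun j => hsub ⟨j, rfl⟩
  choose e he using hfac
  have hge : g ∘ e = g' := funext he
  rw [← hge, ← Function.comp_assoc]
  refine hC.compress_comp hf (T ∘ g) e (Function.Injective.of_comp (hge ▸ hg')) fun i hi => ?_
  refine hdel i ?_
  rintro ⟨l, hl⟩
  exact hi ⟨l, hg ((he l).trans hl)⟩

/-- For a fixed family `T` of `2 * n` points there are few subsamples of size `n`, enumerated by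
`σ`, on which the output of a stable scheme errs at `2 * e` or more entries of `T`. -/
lemma IsStable.card_bad_subsamples_le {C : CompressionScheme F k} (hC : C.IsStable)
    {f : X → Bool} (hf : f ∈ F) {ι : Type*} [Fintype ι] [DecidableEq ι] (T : ι → X) {n : ℕ}
    (hn : 1 ≤ n) (hι : Fintype.card ι = 2 * n) (e : ℕ) (σ : Finset ι → Fin n → ι)
    (hσ : ∀ S, S.card = n → Function.Injective (σ S) ∧ Set.range (σ S) = S) :
    2 ^ e * ((Finset.powersetCard n (Finset.univ : Finset ι)).filter fun S =>
      2 * e ≤ (Finset.univ.filter fun i =>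
        C.output (labeledSample f (T ∘ σ S)) (T i) ≠ f (T i)).card).card
      ≤ 2 ^ (k + 1) * (2 * n).choose n := by
  classical
  let enum : (S : Finset ι) → Fin S.card → ι := fun S j => (S.equivFin.symm j : ι)
  have henum : ∀ S, Function.Injective (enum S) := fun S =>
    Subtype.val_injective.comp S.equivFin.symm.injective
  have hrange : ∀ S : Finset ι, Set.range (enum S) = S := by
    intro S
    ext i
    constructor
    · rintro ⟨j, rfl⟩
      exact (S.equivFin.symm j).2
    · intro hi
      exact ⟨S.equivFin ⟨i, hi⟩, by simp [enum]⟩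
  let comp : Finset ι → List (X × Bool) := fun S =>
    C.compress S.card (labeledSample f (T ∘ enum S))
  have hcomp : ∀ S z, z ∈ comp S → ∃ i ∈ S, (T i, f (T i)) = z := by
    intro S z hz
    obtain ⟨j, hj⟩ := C.compress_subset _ f hf _ z hz
    exact ⟨enum S j, (S.equivFin.symm j).2, hj⟩
  let K : Finset ι → Finset X := fun S => (comp S).toFinset.image Prod.fst
  let E : Finset ι → Finset X := fun S =>
    (Finset.univ.image T).filter fun y => C.reconstruct (comp S) y ≠ f y
  have hmain := card_filter_subsample_le T K E n k e
    (fun S => Finset.card_image_le.trans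
      ((List.toFinset_card_le _).trans (C.length_compress_le _ _)))
    (by
      intro S y hy
      obtain ⟨z, hz, rfl⟩ := Finset.mem_image.1 hy
      obtain ⟨i, hi, rfl⟩ := hcomp S z (List.mem_toFinset.1 hz)
      exact Finset.mem_image_of_mem T hi)
    (by
      intro S
      rw [Finset.disjoint_left]
      intro y hy hyE
      obtain ⟨i, hi, rfl⟩ := Finset.mem_image.1 hy
      obtain ⟨j, rfl⟩ : i ∈ Set.range (enum S) := by rw [hrange]; exact hi
      exact (Finset.mem_filter.1 hyE).2 (C.reconstruct_correct _ f hf (T ∘ enum S) j))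
    (fun S => Finset.filter_subset _ _)
    (by
      intro S V hV
      have : comp (S.filter fun i => T i ∈ V) = comp S := by
        refine hC.compress_comp_eq hf T _ _ (henum _) (henum _) ?_ ?_
        · rw [hrange, hrange]
          exact Finset.coe_subset.2 (Finset.filter_subset _ _)
        · intro j hj hmem
          rw [hrange] at hj
          refine hj (Finset.mem_coe.2 (Finset.mem_filter.2 ⟨(S.equivFin.symm j).2, hV ?_⟩))
          exact Finset.mem_image.2 ⟨_, List.mem_toFinset.2 hmem, rfl⟩
      simp only [E, this])
  have hsame : ∀ S ∈ Finset.powersetCard n (Finset.univ : Finset ι),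
      C.output (labeledSample f (T ∘ σ S)) = C.reconstruct (comp S) := by
    intro S hS
    obtain ⟨h1, h2⟩ := hσ S (Finset.mem_powersetCard.1 hS).2
    unfold output
    congr 1
    refine hC.compress_comp_eq hf T _ _ (henum S) h1 (by rw [h2, hrange]) ?_
    intro j hj
    rw [h2] at hj
    exact absurd (S.equivFin.symm j).2 hj
  have hset : ((Finset.powersetCard n (Finset.univ : Finset ι)).filter fun S =>
      2 * e ≤ (Finset.univ.filter fun i =>
        C.output (labeledSample f (T ∘ σ S)) (T i) ≠ f (T i)).card) =
      (Finset.powersetCard n (Finset.univ : Finset ι)).filter fun S =>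
        2 * e ≤ (Finset.univ.filter fun i => T i ∈ E S).card := by
    refine Finset.filter_congr fun S hS => ?_
    rw [hsame S hS]
    simp [E]
  rw [hset]
  rw [hι] at hmain
  calc _ ≤ 2 ^ e * (2 ^ (k + 1) * (2 * n - e).choose n) := Nat.mul_le_mul_left _ hmain
    _ = 2 ^ (k + 1) * (2 ^ e * (2 * n - e).choose n) := by ring
    _ ≤ _ := Nat.mul_le_mul_left _ (two_pow_mul_choose_sub_le n e hn)

end CompressionScheme

/-! ### Product measures and exchangeability -/

instance {X : Type u} [MeasurableSpace X] (P : Measure X) [IsProbabilityMeasure P] (n : ℕ) :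
    IsProbabilityMeasure (iidLaw P n) := by
  unfold iidLaw; infer_instance

/-- If no point lies in more than `N` of finitely many events, then their probabilities sum up to
at most `N`. -/
lemma sum_measureReal_le_of_card_le {Ω α : Type*} [MeasurableSpace Ω] (μ : Measure Ω)
    [IsProbabilityMeasure μ] (s : Finset α) (A : α → Set Ω) (hA : ∀ a ∈ s, MeasurableSet (A a))
    (N : ℝ) (hN : ∀ (ω : Ω) (t : Finset α), t ⊆ s → (∀ a ∈ t, ω ∈ A a) → (t.card : ℝ) ≤ N) :
    ∑ a ∈ s, μ.real (A a) ≤ N := by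
  classical
  have hint : ∀ a ∈ s, Integrable ((A a).indicator fun _ => (1 : ℝ)) μ := fun a ha =>
    (integrable_const 1).indicator (hA a ha)
  calc ∑ a ∈ s, μ.real (A a) = ∑ a ∈ s, ∫ ω, (A a).indicator (fun _ => (1 : ℝ)) ω ∂μ := by
        refine Finset.sum_congr rfl fun a ha => ?_
        rw [integral_indicator_const _ (hA a ha), smul_eq_mul, mul_one]
    _ = ∫ ω, ∑ a ∈ s, (A a).indicator (fun _ => (1 : ℝ)) ω ∂μ := (integral_finsetSum s hint).symm
    _ ≤ ∫ _, N ∂μ := by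
        refine integral_mono (integrable_finsetSum s hint) (integrable_const N) fun ω => ?_
        simp only [Set.indicator_apply, Finset.sum_boole]
        exact hN ω _ (Finset.filter_subset _ _) fun a ha => (Finset.mem_filter.1 ha).2
    _ = N := by simp

/-- Selecting distinct coordinates of an i.i.d. family gives an i.i.d. family. -/
lemma measurePreserving_pi_comp_injective {X : Type u} [MeasurableSpace X] (P : Measure X)
    [IsProbabilityMeasure P] {ι κ : Type*} [Fintype ι] [Fintype κ] (g : κ → ι)
    (hg : Function.Injective g) :
    MeasurePreserving (fun x : ι → X => x ∘ g) (Measure.pi fun _ => P)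
      (Measure.pi fun _ => P) := by
  classical
  have hmeas : Measurable fun x : ι → X => x ∘ g :=
    measurable_pi_lambda _ fun j => measurable_pi_apply (g j)
  refine ⟨hmeas, (Measure.pi_eq fun s hs => ?_).symm⟩
  rw [Measure.map_apply hmeas (MeasurableSet.univ_pi hs)]
  have : (fun x : ι → X => x ∘ g) ⁻¹' Set.univ.pi s
      = Set.univ.pi fun i => ⋂ j : κ, ⋂ _ : g j = i, s j := by
    ext x
    simp only [Set.mem_preimage, Set.mem_univ_pi, Function.comp_apply, Set.mem_iInter]
    exact ⟨fun h i j hj => hj ▸ h j, fun h j => h (g j) j rfl⟩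
  rw [this, Measure.pi_pi]
  have h1 : ∀ j, P (⋂ j' : κ, ⋂ _ : g j' = g j, s j') = P (s j) := by
    intro j
    congr 1
    ext y
    simp only [Set.mem_iInter]
    exact ⟨fun h => h j rfl, fun h j' hj' => hg hj' ▸ h⟩
  rw [← Finset.prod_congr rfl fun j _ => h1 j,
    ← Finset.prod_image (s := Finset.univ) (g := g)
      (f := fun i => P (⋂ j' : κ, ⋂ _ : g j' = i, s j')) (fun a _ b _ h => hg h)]
  refine (Finset.prod_subset (Finset.subset_univ _) fun i _ hi => ?_).symm
  have : (⋂ j' : κ, ⋂ _ : g j' = i, s j') = Set.univ := by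
    refine Set.iInter_eq_univ.2 fun j => Set.iInter_eq_univ.2 fun hj => ?_
    exact absurd (Finset.mem_image.2 ⟨j, Finset.mem_univ _, hj⟩) hi
  rw [this, measure_univ]

/-- An i.i.d. family of points indexed by `ι`, split into two halves by an enumeration of `ι`,
has the law of two independent samples. -/
lemma pi_measureReal_split {X : Type u} [MeasurableSpace X] (P : Measure X)
    [IsProbabilityMeasure P] {ι : Type*} [Fintype ι] {n m : ℕ} (σ : Fin n ⊕ Fin m ≃ ι)
    {B : Set ((Fin n → X) × (Fin m → X))} (hB : MeasurableSet B) :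
    (Measure.pi fun _ : ι => P).real {T | (T ∘ σ ∘ Sum.inl, T ∘ σ ∘ Sum.inr) ∈ B}
      = ((iidLaw P n).prod (iidLaw P m)).real B := by
  have h1 := measurePreserving_pi_comp_injective P (ι := ι) σ σ.injective
  have h2 := measurePreserving_sumPiEquivProdPi (X := fun _ : Fin n ⊕ Fin m => X) fun _ => P
  exact (h2.comp h1).measureReal_preimage hB.nullMeasurableSet

/-- Lower tail bound for the number of visits of `n` independent points to a set. -/
lemma iidLaw_real_card_lt_le {X : Type u} [MeasurableSpace X] (P : Measure X)
    [IsProbabilityMeasure P] (n m : ℕ) (h f : X → Bool) (hD : MeasurableSet {y | h y ≠ f y}) :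
    (iidLaw P n).real {t | (Finset.univ.filter fun i => h (t i) ≠ f (t i)).card < m}
      ≤ 2 ^ m * (1 - risk P f h / 2) ^ n := by
  -- the Laplace transform of the number of visits at `-log 2`
  let φ : X → ℝ := fun y => if h y ≠ f y then 1 / 2 else 1
  have hφ : ∫ y, φ y ∂P = 1 - risk P f h / 2 := by
    have : φ = fun y => 1 - ({y | h y ≠ f y}.indicator (fun _ => (1 / 2 : ℝ)) y) := by
      funext y
      by_cases hy : h y = f y <;> simp [φ, hy] <;> norm_num
    rw [this, integral_sub (integrable_const _) ((integrable_const _).indicator hD),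
      integral_indicator_const _ hD]
    simp [risk]
    ring
  have hprod : ∀ t : Fin n → X, ∏ i, φ (t i)
      = (1 / 2 : ℝ) ^ (Finset.univ.filter fun i => h (t i) ≠ f (t i)).card := by
    intro t
    simp only [φ, Finset.prod_ite, Finset.prod_const, one_pow, mul_one]
  have hφm : Measurable φ := Measurable.ite hD measurable_const measurable_const
  have hint : Integrable (fun t : Fin n → X => ∏ i, φ (t i)) (iidLaw P n) := by
    refine Integrable.of_bound (C := 1)
      (Finset.measurable_prod _ fun i _ => hφm.comp (measurable_pi_apply i)).aestronglyMeasurable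
      (ae_of_all _ fun t => ?_)
    rw [hprod, Real.norm_of_nonneg (by positivity)]
    exact pow_le_one₀ (by norm_num) (by norm_num)
  have hmarkov := mul_meas_ge_le_integral_of_nonneg (μ := iidLaw P n)
    (ae_of_all _ fun t => by
      change (0 : ℝ) ≤ ∏ i, φ (t i)
      rw [hprod]; positivity) hint ((1 / 2) ^ m)
  have hval : ∫ t, ∏ i, φ (t i) ∂(iidLaw P n) = (1 - risk P f h / 2) ^ n := by
    rw [iidLaw, integral_fintype_prod_eq_pow φ, hφ, Fintype.card_fin]
  rw [hval] at hmarkov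
  have hsub : (iidLaw P n).real {t | (Finset.univ.filter fun i => h (t i) ≠ f (t i)).card < m}
      ≤ (iidLaw P n).real {t | (1 / 2 : ℝ) ^ m ≤ ∏ i, φ (t i)} := by
    refine measureReal_mono fun t ht => ?_
    change (1 / 2 : ℝ) ^ m ≤ ∏ i, φ (t i)
    rw [hprod]
    have ht : (Finset.univ.filter fun i => h (t i) ≠ f (t i)).card < m := ht
    exact pow_le_pow_of_le_one (by norm_num) (by norm_num) ht.le
  calc _ ≤ _ := hsub
    _ = 2 ^ m * ((1 / 2) ^ m * (iidLaw P n).real {t | (1 / 2 : ℝ) ^ m ≤ ∏ i, φ (t i)}) := by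
        rw [← mul_assoc, ← mul_pow]; norm_num
    _ ≤ _ := by gcongr

/-! ### Risk bounds for stable schemes -/

namespace CompressionScheme

variable {X : Type u} [MeasurableSpace X] {F : Set (X → Bool)} {k : ℕ}

lemma measurableSet_output_ne {C : CompressionScheme F k} {f : X → Bool} (hf : Measurable f)
    {m : ℕ} (hm : Measurable fun q : (Fin m → X) × X => C.output (labeledSample f q.1) q.2) :
    MeasurableSet {q : (Fin m → X) × X | C.output (labeledSample f q.1) q.2 ≠ f q.2} :=
  (measurableSet_eq_fun hm (hf.comp measurable_snd)).compl

lemma measurable_risk_output {C : CompressionScheme F k} {f : X → Bool} (hf : Measurable f)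
    {m : ℕ} (hm : Measurable fun q : (Fin m → X) × X => C.output (labeledSample f q.1) q.2)
    (P : Measure X) [IsProbabilityMeasure P] :
    Measurable fun x : Fin m → X => risk P f (C.output (labeledSample f x)) :=
  (measurable_measure_prodMk_left (measurableSet_output_ne hf hm)).ennreal_toReal

/-- Leave-one-out bound: the expected risk is the probability of an error at an additional
point, and among `n + 1` exchangeable points at most `k` are misclassified by the scheme trained
on the other ones. -/
lemma IsStable.integral_risk_le {C : CompressionScheme F k} (hC : C.IsStable)
    {f : X → Bool} (hfF : f ∈ F) (hf : Measurable f)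
    {n : ℕ} (hm : Measurable fun q : (Fin n → X) × X => C.output (labeledSample f q.1) q.2)
    (P : Measure X) [IsProbabilityMeasure P] :
    Integrable (fun x => risk P f (C.output (labeledSample f x))) (iidLaw P n) ∧
      ∫ x, risk P f (C.output (labeledSample f x)) ∂(iidLaw P n) ≤ (k : ℝ) / ((n : ℝ) + 1) := by
  classical
  have hint : Integrable (fun x => risk P f (C.output (labeledSample f x))) (iidLaw P n) := by
    refine Integrable.of_bound (C := 1) (measurable_risk_output hf hm P).aestronglyMeasurable
      (ae_of_all _ fun x => ?_)
    exact (Real.norm_of_nonneg measureReal_nonneg).trans_le measureReal_le_one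
  refine ⟨hint, ?_⟩
  have hD := measurableSet_output_ne hf hm
  have hD' : MeasurableSet (Prod.swap ⁻¹'
      {q : (Fin n → X) × X | C.output (labeledSample f q.1) q.2 ≠ f q.2}) := measurable_swap hD
  have hprod : (P.prod (iidLaw P n)).real (Prod.swap ⁻¹'
      {q : (Fin n → X) × X | C.output (labeledSample f q.1) q.2 ≠ f q.2})
      = ∫ x, risk P f (C.output (labeledSample f x)) ∂(iidLaw P n) := by
    have hnonneg : 0 ≤ᵐ[iidLaw P n] fun x => risk P f (C.output (labeledSample f x)) :=
      ae_of_all _ fun x => measureReal_nonneg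
    rw [measureReal_def, Measure.prod_apply_symm hD',
      integral_eq_lintegral_of_nonneg_ae hnonneg hint.aestronglyMeasurable]
    congr 1
    refine lintegral_congr fun x => ?_
    exact (ofReal_measureReal (measure_ne_top _ _)).symm
  let A : Fin (n + 1) → Set (Fin (n + 1) → X) := fun i =>
    {x | C.output (labeledSample f (i.removeNth x)) (x i) ≠ f (x i)}
  have hpres : ∀ i : Fin (n + 1), MeasurePreserving (fun x : Fin (n + 1) → X =>
      (x i, i.removeNth x)) (iidLaw P (n + 1)) (P.prod (iidLaw P n)) := fun i =>
    measurePreserving_piFinSuccAbove (fun _ => P) i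
  have hA : ∀ i, MeasurableSet (A i) := fun i => (hpres i).measurable hD'
  have hAval : ∀ i, (iidLaw P (n + 1)).real (A i)
      = ∫ x, risk P f (C.output (labeledSample f x)) ∂(iidLaw P n) := fun i => by
    rw [← hprod]
    exact (hpres i).measureReal_preimage hD'.nullMeasurableSet
  have hsum := sum_measureReal_le_of_card_le (iidLaw P (n + 1)) Finset.univ A (fun i _ => hA i) k
    (by
      intro x t _ ht
      -- an error at `x i` forces `x i` into the compression set of the whole sample
      have hmem : ∀ i ∈ t,
          labeledSample f x i ∈ C.compress (n + 1) (labeledSample f x) := by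
        intro i hi
        by_contra hnot
        refine ht i hi ?_
        have := hC n f hfF x i hnot
        have hcorr := C.reconstruct_correct (n + 1) f hfF x i
        rw [← this] at hcorr
        exact hcorr
      -- repeated points are classified correctly, because a copy remains in the sample
      have hinj : Set.InjOn (labeledSample f x) t := by
        intro i hi j hj hij
        by_contra hne
        obtain ⟨l, hl⟩ := Fin.exists_succAbove_eq (Ne.symm hne)
        refine ht i hi ?_
        have hcorr := C.reconstruct_correct n f hfF (i.removeNth x) l
        have hxi : i.removeNth x l = x i := by
          rw [Fin.removeNth_apply, hl]
          exact (congrArg Prod.fst hij).symm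
        rw [hxi] at hcorr
        exact hcorr
      have := Finset.card_le_card_of_injOn (s := t)
        (t := (C.compress (n + 1) (labeledSample f x)).toFinset) (labeledSample f x)
        (fun i hi => List.mem_toFinset.2 (hmem i hi)) hinj
      exact_mod_cast this.trans ((List.toFinset_card_le _).trans (C.length_compress_le _ _)))
  simp only [hAval, Finset.sum_const, Finset.card_univ, Fintype.card_fin, nsmul_eq_mul] at hsum
  rw [le_div_iff₀ (by positivity), mul_comm]
  exact_mod_cast hsum

/-- Double-sample bound: it is unlikely that the output on a sample of size `n` errs at `2 * e`
points of an independent sample of size `n`. -/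
lemma IsStable.two_pow_mul_prod_real_le {C : CompressionScheme F k} (hC : C.IsStable)
    {f : X → Bool} (hfF : f ∈ F) {n : ℕ} (hn : 1 ≤ n) (e : ℕ)
    (P : Measure X) [IsProbabilityMeasure P]
    (hB : MeasurableSet {q : (Fin n → X) × (Fin n → X) | 2 * e ≤ (Finset.univ.filter fun i =>
      C.output (labeledSample f q.1) (q.2 i) ≠ f (q.2 i)).card}) :
    2 ^ e * ((iidLaw P n).prod (iidLaw P n)).real
      {q : (Fin n → X) × (Fin n → X) | 2 * e ≤ (Finset.univ.filter fun i =>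
        C.output (labeledSample f q.1) (q.2 i) ≠ f (q.2 i)).card} ≤ 2 ^ (k + 1) := by
  classical
  set B := {q : (Fin n → X) × (Fin n → X) | 2 * e ≤ (Finset.univ.filter fun i =>
      C.output (labeledSample f q.1) (q.2 i) ≠ f (q.2 i)).card} with hBdef
  have hσ : ∀ S : Finset (Fin n ⊕ Fin n), ∃ σ : Fin n ⊕ Fin n ≃ Fin n ⊕ Fin n,
      S.card = n → Set.range (σ ∘ Sum.inl) = S := by
    intro S
    by_cases hS : S.card = n
    · obtain ⟨σ, hσ⟩ := Equiv.Perm.exists_map_finset_eq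
        (Finset.univ.map (Function.Embedding.inl : Fin n ↪ Fin n ⊕ Fin n)) S (by simp [hS])
      refine ⟨σ, fun _ => ?_⟩
      rw [← hσ]
      ext i
      simp [Equiv.eq_symm_apply]
    · exact ⟨Equiv.refl _, fun h => absurd h hS⟩
  choose σ hσ using hσ
  have hsum := sum_measureReal_le_of_card_le (Measure.pi fun _ : Fin n ⊕ Fin n => P)
    (Finset.powersetCard n (Finset.univ : Finset (Fin n ⊕ Fin n)))
    (fun S => {T | (T ∘ σ S ∘ Sum.inl, T ∘ σ S ∘ Sum.inr) ∈ B})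
    (fun S _ => by
      refine Measurable.prodMk ?_ ?_ hB
      · exact measurable_pi_lambda _ fun j => measurable_pi_apply _
      · exact measurable_pi_lambda _ fun j => measurable_pi_apply _)
    (2 ^ (k + 1) * (2 * n).choose n / 2 ^ e)
    (by
      intro T t hts ht
      have hcount := hC.card_bad_subsamples_le hfF T hn (by simp; ring) e
        (fun S => σ S ∘ Sum.inl)
        (fun S hS => ⟨(σ S).injective.comp Sum.inl_injective, hσ S hS⟩)
      rw [le_div_iff₀ (by positivity), mul_comm]
      have hcount' := (Nat.cast_le (α := ℝ)).2 hcount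
      push_cast at hcount'
      refine le_trans ?_ hcount'
      refine mul_le_mul_of_nonneg_left ?_ (by positivity)
      refine Nat.cast_le.2 (Finset.card_le_card fun S hS => ?_)
      refine Finset.mem_filter.2 ⟨hts hS, le_trans (ht S hS) ?_⟩
      refine Finset.card_le_card_of_injOn (fun i => σ S (Sum.inr i)) ?_
        (((σ S).injective.comp Sum.inr_injective).injOn)
      intro i hi
      simpa using hi)
  simp only [pi_measureReal_split P _ hB, Finset.sum_const, Finset.card_powersetCard,
    Finset.card_univ, Fintype.card_sum, Fintype.card_fin, nsmul_eq_mul, ← two_mul] at hsum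
  rw [le_div_iff₀ (by positivity)] at hsum
  have hpos : (0 : ℝ) < (2 * n).choose n := by
    exact_mod_cast Nat.choose_pos (by omega)
  refine le_of_mul_le_mul_left (le_trans (le_of_eq ?_) (hsum.trans (le_of_eq ?_))) hpos
  · ring
  · ring

/-- Exponential tail bound for the risk of a stable scheme. -/
lemma IsStable.real_risk_gt_le {C : CompressionScheme F k} (hC : C.IsStable)
    {f : X → Bool} (hfF : f ∈ F) (hf : Measurable f)
    {n : ℕ} (hn : 1 ≤ n)
    (hm : Measurable fun q : (Fin n → X) × X => C.output (labeledSample f q.1) q.2)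
    (P : Measure X) [IsProbabilityMeasure P] {ε : ℝ} (hε : 4 ≤ ε * n) {e : ℕ}
    (he : 8 * (e : ℝ) ≤ ε * n) :
    2 ^ e * (iidLaw P n).real {x | ε < risk P f (C.output (labeledSample f x))}
      ≤ 2 ^ (k + 2) := by
  have hcount : Measurable fun q : (Fin n → X) × (Fin n → X) => (Finset.univ.filter fun i =>
      C.output (labeledSample f q.1) (q.2 i) ≠ f (q.2 i)).card := by
    simp only [Finset.card_filter]
    refine Finset.measurable_sum _ fun i _ => Measurable.ite ?_ measurable_const measurable_const
    have hpair : Measurable fun q : (Fin n → X) × (Fin n → X) => (q.1, q.2 i) :=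
      measurable_fst.prodMk ((measurable_pi_apply i).comp measurable_snd)
    exact hpair (measurableSet_output_ne hf hm)
  have hB : MeasurableSet {q : (Fin n → X) × (Fin n → X) | 2 * e ≤ (Finset.univ.filter fun i =>
      C.output (labeledSample f q.1) (q.2 i) ≠ f (q.2 i)).card} :=
    measurableSet_le measurable_const hcount
  have hdouble := hC.two_pow_mul_prod_real_le hfF hn e P hB
  set B := {q : (Fin n → X) × (Fin n → X) | 2 * e ≤ (Finset.univ.filter fun i =>
      C.output (labeledSample f q.1) (q.2 i) ≠ f (q.2 i)).card} with hBdef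
  -- given a large risk, the errors on the second sample are numerous with probability `1 / 2`
  have hghost : ∀ x : Fin n → X, ε < risk P f (C.output (labeledSample f x)) →
      (1 / 2 : ℝ) ≤ (iidLaw P n).real (Prod.mk x ⁻¹' B) := by
    intro x hx
    have hcompl : (Prod.mk x ⁻¹' B)ᶜ = {t | (Finset.univ.filter fun i =>
        C.output (labeledSample f x) (t i) ≠ f (t i)).card < 2 * e} := by
      ext t; simp [hBdef]
    have htail := iidLaw_real_card_lt_le P n (2 * e) (C.output (labeledSample f x)) f
      (measurable_prodMk_left (measurableSet_output_ne hf hm))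
    rw [← hcompl, probReal_compl_eq_one_sub (measurable_prodMk_left hB)] at htail
    have hr1 : risk P f (C.output (labeledSample f x)) ≤ 1 := measureReal_le_one
    have hpow : (1 - risk P f (C.output (labeledSample f x)) / 2) ^ n
        ≤ Real.exp (-(ε * n / 2)) := by
      calc _ ≤ (Real.exp (-(ε / 2))) ^ n := by
            refine pow_le_pow_left₀ (by linarith) ?_ n
            have := Real.add_one_le_exp (-(ε / 2))
            linarith
        _ = _ := by rw [← Real.exp_nat_mul]; congr 1; ring
    have h2 : (2 : ℝ) ^ (2 * e) = Real.exp (2 * e * Real.log 2) := by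
      have := Real.exp_nat_mul (Real.log 2) (2 * e)
      rw [Real.exp_log (by norm_num)] at this
      rw [← this]
      push_cast
      rfl
    have hlog := Real.log_two_lt_d9
    have hlog' := Real.log_two_gt_d9
    have hhalf : (1 / 2 : ℝ) = Real.exp (-Real.log 2) := by
      rw [Real.exp_neg, Real.exp_log (by norm_num)]; norm_num
    have hbound : (2 : ℝ) ^ (2 * e) * (1 - risk P f (C.output (labeledSample f x)) / 2) ^ n
        ≤ 1 / 2 := by
      calc _ ≤ Real.exp (2 * e * Real.log 2) * Real.exp (-(ε * n / 2)) := by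
            rw [h2]
            exact mul_le_mul_of_nonneg_left hpow (Real.exp_pos _).le
        _ ≤ 1 / 2 := by
            rw [← Real.exp_add, hhalf, Real.exp_le_exp]
            nlinarith
    linarith
  have hmul : (1 / 2 : ℝ) * (iidLaw P n).real
      {x | ε < risk P f (C.output (labeledSample f x))}
      ≤ ((iidLaw P n).prod (iidLaw P n)).real B := by
    have h1 := mul_meas_ge_le_lintegral (μ := iidLaw P n)
      (measurable_measure_prodMk_left (ν := iidLaw P n) hB) (ENNReal.ofReal (1 / 2))
    rw [← Measure.prod_apply hB] at h1
    have h2 : ENNReal.ofReal (1 / 2) * iidLaw P n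
        {x | ε < risk P f (C.output (labeledSample f x))}
        ≤ (iidLaw P n).prod (iidLaw P n) B := by
      refine le_trans (mul_le_mul_right (measure_mono fun x hx => ?_) _) h1
      exact ENNReal.ofReal_le_of_le_toReal (hghost x hx)
    have h3 := ENNReal.toReal_mono (measure_ne_top _ _) h2
    rw [ENNReal.toReal_mul, ENNReal.toReal_ofReal (by norm_num)] at h3
    exact h3
  calc _ = 2 * (2 ^ e * ((1 / 2 : ℝ) * (iidLaw P n).real
        {x | ε < risk P f (C.output (labeledSample f x))})) := by ring
    _ ≤ 2 * 2 ^ (k + 1) := by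
        refine mul_le_mul_of_nonneg_left (le_trans ?_ hdouble) (by norm_num)
        exact mul_le_mul_of_nonneg_left hmul (by positivity)
    _ = 2 ^ (k + 2) := by ring

end CompressionScheme

/-! ### The truncated logarithm and the high probability bound -/

lemma one_le_truncLog (x : ℝ) : 1 ≤ truncLog x := by
  have := Real.log_le_log (Real.exp_pos 1) (le_max_right x (Real.exp 1))
  rwa [Real.log_exp] at this

lemma exp_neg_truncLog_inv_le {δ : ℝ} (hδ : 0 < δ) : Real.exp (-truncLog (1 / δ)) ≤ δ := by
  rw [truncLog, Real.exp_neg, Real.exp_log (lt_max_of_lt_right (Real.exp_pos 1))]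
  refine inv_le_of_inv_le₀ hδ ?_
  rw [← one_div]
  exact le_max_left _ _

lemma truncLog_one_div_half_le {δ : ℝ} (hδ : 0 < δ) :
    truncLog (1 / (δ / 2)) ≤ 2 * truncLog (1 / δ) := by
  have h1 := one_le_truncLog (1 / δ)
  have hlog := Real.log_two_lt_d9
  have hpos : (0 : ℝ) < max (1 / δ) (Real.exp 1) := lt_max_of_lt_right (Real.exp_pos 1)
  have h2 : truncLog (1 / (δ / 2)) ≤ Real.log 2 + truncLog (1 / δ) := by
    rw [truncLog, truncLog, ← Real.log_mul (by norm_num) hpos.ne']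
    refine Real.log_le_log (lt_max_of_lt_right (Real.exp_pos 1)) (max_le ?_ ?_)
    · calc 1 / (δ / 2) = 2 * (1 / δ) := by field_simp
        _ ≤ _ := by gcongr; exact le_max_left _ _
    · have := le_max_right (1 / δ) (Real.exp 1)
      linarith
  linarith

namespace CompressionScheme

variable {X : Type u} [MeasurableSpace X] {F : Set (X → Bool)} {k : ℕ}

/-- The risk of a stable scheme of size `k` is of order `(k + log (1 / δ)) / n` with probability
`1 - δ`. -/
lemma IsStable.one_sub_le_real_risk_le {C : CompressionScheme F k} (hC : C.IsStable)
    {f : X → Bool} (hfF : f ∈ F) (hf : Measurable f)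
    {n : ℕ} (hn : 1 ≤ n)
    (hm : Measurable fun q : (Fin n → X) × X => C.output (labeledSample f q.1) q.2)
    (P : Measure X) [IsProbabilityMeasure P] {δ : ℝ} (hδ : 0 < δ) :
    1 - δ ≤ (iidLaw P n).real {x | risk P f (C.output (labeledSample f x)) ≤
      64 * ((k : ℝ) + truncLog (1 / δ)) / n} := by
  set L := truncLog (1 / δ) with hL
  have hL1 : 1 ≤ L := one_le_truncLog _
  have hn0 : (0 : ℝ) < n := by exact_mod_cast hn
  set ε := 64 * ((k : ℝ) + L) / n with hεdef
  have hεn : ε * n = 64 * ((k : ℝ) + L) := by rw [hεdef]; field_simp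
  have hk0 : (0 : ℝ) ≤ k := Nat.cast_nonneg k
  -- with `8 * e` just below `ε * n`, the factor `2 ^ e` beats `2 ^ (k + 2) / δ`
  set e := ⌊8 * ((k : ℝ) + L)⌋₊ with hedef
  have he1 : (e : ℝ) ≤ 8 * ((k : ℝ) + L) := Nat.floor_le (by positivity)
  have he2 : 8 * ((k : ℝ) + L) < e + 1 := Nat.lt_floor_add_one _
  have htail := hC.real_risk_gt_le hfF hf hn hm P (ε := ε) (e := e) (by rw [hεn]; linarith)
    (by rw [hεn]; linarith)
  have hcompl : {x : Fin n → X | ε < risk P f (C.output (labeledSample f x))}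
      = {x | risk P f (C.output (labeledSample f x)) ≤ ε}ᶜ := by ext x; simp
  have hmeas : MeasurableSet {x : Fin n → X | risk P f (C.output (labeledSample f x)) ≤ ε} :=
    measurableSet_le (measurable_risk_output hf hm P) measurable_const
  have hδ' : (2 : ℝ) ^ (k + 2) ≤ 2 ^ e * δ := by
    have h2 : ∀ j : ℕ, (2 : ℝ) ^ j = Real.exp (j * Real.log 2) := fun j => by
      rw [Real.exp_nat_mul, Real.exp_log (by norm_num)]
    have hlog' := Real.log_two_gt_d9
    calc (2 : ℝ) ^ (k + 2) ≤ Real.exp (e * Real.log 2 + -L) := by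
          rw [h2, Real.exp_le_exp]
          push_cast
          nlinarith
      _ = 2 ^ e * Real.exp (-L) := by rw [Real.exp_add, ← h2]
      _ ≤ 2 ^ e * δ := mul_le_mul_of_nonneg_left (exp_neg_truncLog_inv_le hδ) (by positivity)
  have hfinal := le_of_mul_le_mul_left (htail.trans hδ') (by positivity)
  rw [hcompl, probReal_compl_eq_one_sub hmeas] at hfinal
  linarith

end CompressionScheme

/-! ### Schemes of size zero and the majority vote -/

namespace CompressionScheme

variable {X : Type u} [MeasurableSpace X] {F : Set (X → Bool)} {k : ℕ}

/-- A scheme of size `0` has a constant output, which is correct everywhere since every point can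
occur in a sample. -/
lemma risk_output_eq_zero {C : CompressionScheme F k} (hk : k = 0) {f : X → Bool} (hfF : f ∈ F)
    (P : Measure X) {n : ℕ} (x : Fin n → X) :
    risk P f (C.output (labeledSample f x)) = 0 := by
  subst hk
  have hnil : ∀ (m : ℕ) (S : Fin m → X × Bool), C.compress m S = [] := fun m S =>
    List.length_eq_zero_iff.1 (Nat.le_zero.1 (C.length_compress_le m S))
  have : {y | C.output (labeledSample f x) y ≠ f y} = ∅ := by
    refine Set.eq_empty_of_forall_notMem fun y hy => hy ?_
    have := C.reconstruct_correct 1 f hfF (fun _ => y) 0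
    rw [hnil] at this
    rw [output, hnil]
    exact this
  rw [risk, this, measureReal_empty]

/-- The majority vote errs only where one of its last two voters errs. -/
lemma risk_majorityOutput_le {C : CompressionScheme F k} {f : X → Bool} (P : Measure X)
    [IsProbabilityMeasure P] {n : ℕ} (x : Fin (3 * n) → X) :
    risk P f (C.majorityOutput (labeledSample f x)) ≤
      risk P f (C.output (labeledSample f (x ∘ Fin.castLE (by omega : 2 * n ≤ 3 * n)))) +
      risk P f (C.output (labeledSample f x)) := by
  have h23 : 2 * n ≤ 3 * n := by omega
  refine (measureReal_mono (fun y hy => ?_) (measure_ne_top _ _)).trans (measureReal_union_le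
    {y | C.output (labeledSample f (x ∘ Fin.castLE h23)) y ≠ f y}
    {y | C.output (labeledSample f x) y ≠ f y})
  by_contra hnot
  have h1 : C.output (labeledSample f (x ∘ Fin.castLE h23)) y = f y := by
    by_contra h; exact hnot (Or.inl h)
  have h2 : C.output (labeledSample f x) y = f y := by
    by_contra h; exact hnot (Or.inr h)
  refine hy ?_
  have h1' : C.output (Fin.take (2 * n) h23 (labeledSample f x)) y = f y := h1
  rw [majorityOutput, h1', h2]
  cases f y <;> simp [majority]

/-- The majority vote of a stable scheme on `3 * n` points satisfies a bound of the same order as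
the scheme itself, by a union bound for two of its voters. -/
lemma IsStable.one_sub_le_real_risk_majorityOutput_le {C : CompressionScheme F k}
    (hC : C.IsStable) {f : X → Bool} (hfF : f ∈ F) (hf : Measurable f)
    (hm : ∀ m : ℕ, Measurable fun q : (Fin m → X) × X => C.output (labeledSample f q.1) q.2)
    {n : ℕ} (hn : 1 ≤ n) (P : Measure X) [IsProbabilityMeasure P] {δ : ℝ} (hδ : 0 < δ) :
    1 - δ ≤ (iidLaw P (3 * n)).real {x | risk P f (C.majorityOutput (labeledSample f x)) ≤
      256 * ((k : ℝ) + truncLog (1 / δ)) / n} := by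
  have hδ2 : 0 < δ / 2 := by positivity
  have hL := truncLog_one_div_half_le hδ
  have hL1 := one_le_truncLog (1 / (δ / 2))
  have hn0 : (0 : ℝ) < n := by exact_mod_cast hn
  have hk0 : (0 : ℝ) ≤ k := Nat.cast_nonneg k
  let G : ∀ m : ℕ, Set (Fin m → X) := fun m =>
    {x | risk P f (C.output (labeledSample f x)) ≤ 64 * ((k : ℝ) + truncLog (1 / (δ / 2))) / m}
  have hG : ∀ m, MeasurableSet (G m) := fun m =>
    measurableSet_le (measurable_risk_output hf (hm m) P) measurable_const
  have h23 : 2 * n ≤ 3 * n := by omega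
  have hG2 : 1 - δ / 2 ≤ (iidLaw P (2 * n)).real (G (2 * n)) :=
    hC.one_sub_le_real_risk_le hfF hf (by omega : 1 ≤ 2 * n) (hm _) P hδ2
  have hG3 : 1 - δ / 2 ≤ (iidLaw P (3 * n)).real (G (3 * n)) :=
    hC.one_sub_le_real_risk_le hfF hf (by omega : 1 ≤ 3 * n) (hm _) P hδ2
  have hpres := measurePreserving_pi_comp_injective P (Fin.castLE h23)
    (Fin.castLE_injective _)
  have hpre : (iidLaw P (3 * n)).real ((fun x : Fin (3 * n) → X =>
      x ∘ Fin.castLE h23) ⁻¹' G (2 * n))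
      = (iidLaw P (2 * n)).real (G (2 * n)) :=
    hpres.measureReal_preimage (hG _).nullMeasurableSet
  set G' := (fun x : Fin (3 * n) → X => x ∘ Fin.castLE h23) ⁻¹' G (2 * n)
    with hG'
  have hinter : 1 - δ ≤ (iidLaw P (3 * n)).real (G' ∩ G (3 * n)) := by
    have h1 := measureReal_union_add_inter (μ := iidLaw P (3 * n)) (s := G') (hG (3 * n))
    have h2 : (iidLaw P (3 * n)).real (G' ∪ G (3 * n)) ≤ 1 := measureReal_le_one
    rw [hpre] at h1
    linarith
  refine hinter.trans (measureReal_mono fun x hx => ?_)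
  have hx2 : risk P f (C.output (labeledSample f (x ∘ Fin.castLE h23))) ≤ _ := hx.1
  have hx3 : risk P f (C.output (labeledSample f x)) ≤ _ := hx.2
  refine (risk_majorityOutput_le P x).trans ((add_le_add hx2 hx3).trans ?_)
  have h4 : (k : ℝ) + truncLog (1 / (δ / 2)) ≤ 2 * (k + truncLog (1 / δ)) := by linarith
  have h5 : ∀ m : ℕ, (n : ℝ) ≤ m → 64 * ((k : ℝ) + truncLog (1 / (δ / 2))) / m
      ≤ 64 * (2 * (k + truncLog (1 / δ))) / n := fun m hnm => by gcongr; linarith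
  calc _ ≤ 64 * (2 * ((k : ℝ) + truncLog (1 / δ))) / n
        + 64 * (2 * ((k : ℝ) + truncLog (1 / δ))) / n :=
        add_le_add (h5 _ (by push_cast; linarith)) (h5 _ (by push_cast; linarith))
    _ = _ := by ring

end CompressionScheme

/-! ### The risk bounds -/

theorem mainTheorem1 :
    ∃ (c : ℝ) (c' : ℝ → ℝ), 0 < c ∧ (∀ A : ℝ, 0 < A → 0 < c' A) ∧
    ∀ (X : Type u) [MeasurableSpace X] (P : Measure X) [IsProbabilityMeasure P]
      (F : Set (X → Bool)) (_ : ∀ f ∈ F, Measurable f)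
      (k : ℕ) (C : CompressionScheme F k) (_ : C.IsStable)
      (f : X → Bool) (_ : f ∈ F)
      (_ : ∀ m : ℕ, Measurable fun q : (Fin m → X) × X => C.output (labeledSample f q.1) q.2)
      (n : ℕ) (_ : 1 ≤ n),
      -- in-expectation bound
      (Integrable (fun x => risk P f (C.output (labeledSample f x))) (iidLaw P n) ∧
        ∫ x, risk P f (C.output (labeledSample f x)) ∂(iidLaw P n) ≤ (k : ℝ) / ((n : ℝ) + 1)) ∧
      ∀ (δ : ℝ) (_ : 0 < δ) (_ : δ < 1),
        -- high probability bound for the stable scheme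
        (1 - δ ≤ (iidLaw P n).real {x |
          risk P f (C.output (labeledSample f x)) ≤
            c * ((k : ℝ) * truncLog (1 / δ) / (n : ℝ))}) ∧
        -- high probability bound for the majority vote, on a sample of size `3n`
        (∀ (A : ℝ) (_ : 0 < A) (H : Set (X → Bool)) (d : ℕ),
          (∀ l : List (X × Bool), l.length ≤ k → C.reconstruct l ∈ H) →
          vcDimension H = (d : ℕ∞) → (d : ℝ) ≤ A * (k : ℝ) →
          1 - δ ≤ (iidLaw P (3 * n)).real {x |
            risk P f (C.majorityOutput (labeledSample f x)) ≤
              c' A * ((k : ℝ) * truncLog (k : ℝ) / (n : ℝ) + truncLog (1 / δ) / (n : ℝ))}) ∧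
        -- high probability bound for the homogeneous scheme
        (C.IsHomogeneous →
          1 - δ ≤ (iidLaw P n).real {x |
            risk P f (C.output (labeledSample f x)) ≤
              c * ((k : ℝ) / (n : ℝ) + truncLog (1 / δ) / (n : ℝ))}) := by
  refine ⟨128, fun _ => 256, by norm_num, fun _ _ => by norm_num, ?_⟩
  intro X _ P _ F hF k C hC f hfF hm n hn
  have hf := hF f hfF
  have hn0 : (0 : ℝ) < n := by exact_mod_cast hn
  refine ⟨hC.integral_risk_le hfF hf (hm n) P, fun δ hδ _ => ?_⟩
  have hL := one_le_truncLog (1 / δ)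
  have hmain := hC.one_sub_le_real_risk_le hfF hf hn (hm n) P hδ
  refine ⟨?_, fun A _ H d _ _ _ => ?_, fun _ => ?_⟩
  · refine hmain.trans (measureReal_mono fun x hx => ?_)
    have hx : risk P f (C.output (labeledSample f x)) ≤ _ := hx
    change risk P f (C.output (labeledSample f x)) ≤ _
    rcases Nat.eq_zero_or_pos k with hk | hk
    · rw [CompressionScheme.risk_output_eq_zero hk hfF]
      positivity
    · have hk1 : (1 : ℝ) ≤ k := by exact_mod_cast hk
      refine hx.trans ?_
      rw [← mul_div_assoc]
      refine div_le_div_of_nonneg_right ?_ hn0.le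
      nlinarith
  · refine (hC.one_sub_le_real_risk_majorityOutput_le hfF hf hm hn P hδ).trans
      (measureReal_mono fun x hx => ?_)
    have hx : risk P f (C.majorityOutput (labeledSample f x)) ≤ _ := hx
    refine hx.trans ?_
    rw [← add_div, ← mul_div_assoc]
    refine div_le_div_of_nonneg_right ?_ hn0.le
    have hk0 : (0 : ℝ) ≤ k := Nat.cast_nonneg k
    have := mul_le_mul_of_nonneg_left (one_le_truncLog k) hk0
    linarith
  · refine hmain.trans (measureReal_mono fun x hx => ?_)
    have hx : risk P f (C.output (labeledSample f x)) ≤ _ := hx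
    refine hx.trans ?_
    rw [← add_div, ← mul_div_assoc]
    refine div_le_div_of_nonneg_right ?_ hn0.le
    have hk0 : (0 : ℝ) ≤ k := Nat.cast_nonneg k
    linarith
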